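/- Homology is reduced simplicial homology with coefficients in $\mathbb{Z}_2$ (the empty set is a face, of dimension $-1$). A set of points in $\mathbb{R}^d$ is in general position if each of its subsets of at most $d+1$ points is affinely independent. For $P\subseteq\mathbb{R}^d$ let $G(P)$ be the simplicial complex of all finite subsets of $P$ in general position, and let $\varphi(P)\in\mathbb{N}\cup\{\infty\}$ be the maximal size of a subset of $P$ in general position. A complex $K$ is $k$-connected if $\tilde H_i(K)=0$ for all $-1\le i\le k$. Let $g_d(k)$ be the minimum integer $m$ such that for every $P\subseteq\mathbb{R}^d$ with $\varphi(P)\ge m$ the complex $G(P)$ is $k$-connected. Let $d\ge 2$. (1) For every $n$ there is a set of $n$ points in general position in $\mathbb{R}^d$. Let $A\subset\mathbb{R}^d$ be a set of $n>d$ points in general position and put $N=\binom{n}{d}$. Then there is a set $B$ of $N$ points in $\mathbb{R}^d$ in general position, disjoint from $A$, such that every hyperplane spanned by $d$ points of $A$ contains exactly one point of $B$, no point of $B$ lies on two of these hyperplanes, and the only affinely dependent subsets of $A\cup B$ with at most $d+1$ points are the sets $S\cup\{x\}$, where $S\subset A$, $|S|=d$, and $x$ is the point of $B$ on the hyperplane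 spanned by $S$. (2) For all such $A$ and $B$, the set $P=A\cup B$ satisfies $|P|=N+n$ and $\varphi(P)=N+d-1$, and for every integer $i$, $$\tilde H_i(G(P))=0 \iff i\neq n-1 .$$ (3) The number $g_d(k)$ exists for every integer $k\ge 0$, and for fixed $d$ we have $g_d(k)=\Theta(k^d)$ as $k\to\infty$. -/

import Mathlib

open Filter Asymptotics

noncomputable section

namespace GenPos

/-! ### Reduced simplicial homology with coefficients in `ZMod 2`

An abstract simplicial complex on `V` is a family of finite subsets of `V` that is closed under
taking subsets, i.e. a `LowerSet (Finset V)`.  The empty face is allowed; it is the unique face of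
dimension `-1` of every complex that has a face at all. -/

section Homology

variable {V : Type*}

/-- The (augmented) simplicial boundary map mod 2 on all formal sums of finite subsets of `V`:
`σ ↦ ∑ v ∈ σ, σ \ {v}`. In particular `{v} ↦ ∅` and `∅ ↦ 0`. -/
def boundary : (Finset V →₀ ZMod 2) →ₗ[ZMod 2] (Finset V →₀ ZMod 2) :=
  open scoped Classical in
  Finsupp.linearCombination (ZMod 2) fun σ : Finset V =>
    ∑ v ∈ σ, Finsupp.single (σ.erase v) (1 : ZMod 2)

/-- `i`-dimensional chains of `K`: formal sums of faces of dimension `i`, that is with `i + 1`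
vertices (`i` is any integer; there are no nonzero chains for `i < -1`). -/
def chains (K : LowerSet (Finset V)) (i : ℤ) : Submodule (ZMod 2) (Finset V →₀ ZMod 2) :=
  Finsupp.supported (ZMod 2) (ZMod 2) {σ : Finset V | σ ∈ K ∧ (σ.card : ℤ) = i + 1}

/-- `i`-dimensional (reduced) cycles. -/
def cycles (K : LowerSet (Finset V)) (i : ℤ) : Submodule (ZMod 2) (Finset V →₀ ZMod 2) :=
  chains K i ⊓ LinearMap.ker boundary

/-- `i`-dimensional boundaries. -/
def boundaries (K : LowerSet (Finset V)) (i : ℤ) : Submodule (ZMod 2) (Finset V →₀ ZMod 2) :=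
  (chains K (i + 1)).map boundary

theorem boundary_single (σ : Finset V) :
    open scoped Classical in
    boundary (Finsupp.single σ (1 : ZMod 2)) =
      ∑ v ∈ σ, Finsupp.single (σ.erase v) (1 : ZMod 2) := by
  simp [boundary]

theorem boundary_boundary (c : Finset V →₀ ZMod 2) : boundary (boundary c) = 0 := by
  classical
  suffices h : (boundary (V := V)).comp boundary = 0 from LinearMap.congr_fun h c
  refine Finsupp.lhom_ext' fun σ => LinearMap.ext_ring ?_
  simp only [LinearMap.comp_apply, Finsupp.lsingle_apply, LinearMap.zero_apply]
  rw [boundary_single, map_sum]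
  simp only [boundary_single]
  rw [Finset.sum_sigma']
  refine Finset.sum_involution (fun p _ => ⟨p.2, p.1⟩) ?_ ?_ ?_ ?_
  · rintro ⟨a, b⟩ _
    dsimp only
    rw [Finset.erase_right_comm, ← Finsupp.single_add]
    have : (1 : ZMod 2) + 1 = 0 := by decide
    simp [this]
  · rintro ⟨a, b⟩ h _ he
    simp only [Finset.mem_sigma, Finset.mem_erase] at h
    simp only [Sigma.mk.injEq] at he
    exact h.2.1 he.1
  · rintro ⟨a, b⟩ h
    simp only [Finset.mem_sigma, Finset.mem_erase] at h ⊢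
    exact ⟨h.2.2, Ne.symm h.2.1, h.1⟩
  · rintro ⟨a, b⟩ _
    rfl

/-- Every boundary is a cycle, so that the quotient below is the usual homology group. -/
theorem boundaries_le_cycles (K : LowerSet (Finset V)) (i : ℤ) :
    boundaries K i ≤ cycles K i := by
  classical
  rintro _ ⟨c, hc, rfl⟩
  refine ⟨?_, boundary_boundary c⟩
  have hc' : (c.support : Set (Finset V)) ⊆ {σ | σ ∈ K ∧ (σ.card : ℤ) = i + 1 + 1} := hc
  change boundary c ∈ chains K i
  rw [boundary, Finsupp.linearCombination_apply, Finsupp.sum]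
  refine Submodule.sum_mem _ fun σ hσ => Submodule.smul_mem _ _ ?_
  refine Submodule.sum_mem _ fun v hv => ?_
  obtain ⟨h1, h2⟩ := hc' hσ
  refine Finsupp.single_mem_supported _ _ ⟨K.lower (Finset.erase_subset v σ) h1, ?_⟩
  have := Finset.card_erase_add_one hv
  omega

/-- The quotient `Z / B` of two submodules `B ≤ Z` of a module. -/
abbrev Subquotient {R M : Type*} [Ring R] [AddCommGroup M] [Module R M] (Z B : Submodule R M) :
    Type _ :=
  ↥Z ⧸ B.submoduleOf Z

theorem subsingleton_subquotient_iff {R M : Type*} [Ring R] [AddCommGroup M] [Module R M]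
    (Z B : Submodule R M) : Subsingleton (Subquotient Z B) ↔ Z ≤ B := by
  rw [Submodule.Quotient.subsingleton_iff, Submodule.submoduleOf_eq_top]

/-- The reduced homology group of `K` in dimension `i` (cycles modulo boundaries), with
coefficients in `ZMod 2`. -/
abbrev ReducedHomology (K : LowerSet (Finset V)) (i : ℤ) : Type _ :=
  Subquotient (cycles K i) (boundaries K i)

/-- The homology vanishes iff every cycle is a boundary. -/
theorem subsingleton_reducedHomology_iff (K : LowerSet (Finset V)) (i : ℤ) :
    Subsingleton (ReducedHomology K i) ↔ cycles K i ≤ boundaries K i :=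
  subsingleton_subquotient_iff _ _

/-- `K` is (homologically) `k`-connected: its reduced homology vanishes in all dimensions `i`
with `-1 ≤ i ≤ k`. -/
def IsHomologicallyConnected (K : LowerSet (Finset V)) (k : ℕ) : Prop :=
  ∀ i : ℤ, -1 ≤ i → i ≤ k → Subsingleton (ReducedHomology K i)

end Homology

/-! ### General position complexes -/

/-- A set of points of `ℝ^d` is in general position if all its subsets of at most `d + 1` points
are affinely independent. -/
def InGeneralPosition {d : ℕ} (Q : Set (EuclideanSpace ℝ (Fin d))) : Prop :=
  ∀ T : Finset (EuclideanSpace ℝ (Fin d)), (T : Set (EuclideanSpace ℝ (Fin d))) ⊆ Q →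
    T.card ≤ d + 1 → AffineIndependent ℝ (fun x : T => (x : EuclideanSpace ℝ (Fin d)))

/-- The general position complex `G(P)`: its faces are the finite subsets of `P` in general
position. -/
def generalPositionComplex {d : ℕ} (P : Set (EuclideanSpace ℝ (Fin d))) :
    LowerSet (Finset (EuclideanSpace ℝ (Fin d))) where
  carrier := {σ | (σ : Set (EuclideanSpace ℝ (Fin d))) ⊆ P ∧
    InGeneralPosition (σ : Set (EuclideanSpace ℝ (Fin d)))}
  lower' := by
    intro σ τ hτ hσ
    have h : (τ : Set (EuclideanSpace ℝ (Fin d))) ⊆ σ := Finset.coe_subset.2 hτ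
    exact ⟨h.trans hσ.1, fun T hT => hσ.2 T (hT.trans h)⟩

/-- `φ(P)`: the maximal size of a subset of `P` in general position (`⊤` if there are arbitrarily
large finite ones). -/
def maxGeneralPosition {d : ℕ} (P : Set (EuclideanSpace ℝ (Fin d))) : ℕ∞ :=
  ⨆ σ ∈ generalPositionComplex P, (σ.card : ℕ∞)

/-- The thresholds `m` such that `G(P)` is `k`-connected for every `P ⊆ ℝ^d` with `φ(P) ≥ m`. -/
def connectivityThresholds (d k : ℕ) : Set ℕ :=
  {m | ∀ P : Set (EuclideanSpace ℝ (Fin d)), (m : ℕ∞) ≤ maxGeneralPosition P →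
    IsHomologicallyConnected (generalPositionComplex P) k}

/-- `g_d(k)`: the least `m` such that `G(P)` is `k`-connected for every `P ⊆ ℝ^d` with
`φ(P) ≥ m`. -/
def g (d k : ℕ) : ℕ := sInf (connectivityThresholds d k)

/-- The choice of `B` for a given finite set `A` of points in `ℝ^d`: `B` consists of
`N = (|A| choose d)` points in general position, none of them in `A`, exactly one of them on each
hyperplane spanned by `d` points of `A`, different ones on different hyperplanes, and `B` is
otherwise generic with respect to `A`: the only affinely dependent sets of at most `d + 1` points
of `A ∪ B` are those formed by `d` points of `A` and the point of `B` on the hyperplane that they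
span. -/
structure IsGenericTransversal {d : ℕ} (A B : Finset (EuclideanSpace ℝ (Fin d))) : Prop where
  card_eq : B.card = A.card.choose d
  genPos : InGeneralPosition (B : Set (EuclideanSpace ℝ (Fin d)))
  disjoint : Disjoint A B
  meets : ∀ S ⊆ A, S.card = d →
    ((B : Set (EuclideanSpace ℝ (Fin d))) ∩
      (affineSpan ℝ (S : Set (EuclideanSpace ℝ (Fin d))) : Set _)).ncard = 1
  injective : ∀ S ⊆ A, S.card = d → ∀ S' ⊆ A, S'.card = d → ∀ x ∈ B,
    x ∈ affineSpan ℝ (S : Set (EuclideanSpace ℝ (Fin d))) →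
    x ∈ affineSpan ℝ (S' : Set (EuclideanSpace ℝ (Fin d))) → S = S'
  generic : ∀ T : Finset (EuclideanSpace ℝ (Fin d)),
    (T : Set (EuclideanSpace ℝ (Fin d))) ⊆ ↑A ∪ ↑B → T.card ≤ d + 1 →
    ¬ AffineIndependent ℝ (fun x : T => (x : EuclideanSpace ℝ (Fin d))) →
    ∃ S ⊆ A, S.card = d ∧ ∃ x ∈ B,
      x ∈ affineSpan ℝ (S : Set (EuclideanSpace ℝ (Fin d))) ∧
      (T : Set (EuclideanSpace ℝ (Fin d))) = insert x (S : Set (EuclideanSpace ℝ (Fin d)))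

end GenPos

end

/-! Upper bound on `g d k`. For finite `W`, a face of the general position complex is a subset of
`W` containing none of the minimal dependent sets of at most `d + 1` points. These forbidden sets
are removed from the list one at a time, inside the link of a set `ρ`. By
`cycles_le_boundaries_of_erase`, removing `f` costs only the homology of the link of `f \ ρ` in
degree `i + 1 - |f \ ρ|`, which is lower than `i` once `|f \ ρ| ≥ 2`. When some vertex `q` lies in
no remaining forbidden set, the complex is a cone. A large set `Q` in general position supplies such
vertices `q`: a flat spanned by at most `d` points of `T` contains at most `d` points of `Q`, and
there are at most `(|T| + 1)^d` such flats, where `|T| ≤ 2k + 2`. Hence a threshold of order `k^d`.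
Chains have finite support, so infinite `P` reduce to finite `W`.

Lower bound. In the complex of `A ∪ B` the set `A` is a facet, since every point of `B` lies on a
hyperplane spanned by `A`. Any other face has trace `τ ≠ A` on `A`; the point of `B` on a hyperplane
through some `a ∈ A \ τ` lies on no hyperplane spanned by `τ`, so the faces with trace `τ` form a
cone. These cones fit together (`cycles_le_boundaries_of_fiberwise_cone`) to make the complex
without `A` acyclic, and restoring `A` creates homology exactly in degree `n - 1`. With `n = k + 1`
this obstructs `k`-connectedness although `φ` has order `k^d`. -/

namespace GenPos

/-! ### Chain operators: cone, contraction and join. -/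

section ChainOperators

variable {V : Type*}

theorem map_mem_of_mem_supported {α M : Type*} [AddCommGroup M] [Module (ZMod 2) M]
    {s : Set α} {N : Submodule (ZMod 2) M} (L : (α →₀ ZMod 2) →ₗ[ZMod 2] M)
    (h : ∀ a ∈ s, L (Finsupp.single a 1) ∈ N) {c : α →₀ ZMod 2}
    (hc : c ∈ Finsupp.supported (ZMod 2) (ZMod 2) s) : L c ∈ N := by
  rw [Finsupp.supported_eq_span_single] at hc
  have : Submodule.span (ZMod 2) ((fun i => Finsupp.single i (1 : ZMod 2)) '' s) ≤ N.comap L := by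
    rw [Submodule.span_le]
    rintro _ ⟨a, ha, rfl⟩
    exact h a ha
  exact this hc

theorem add_self_chain {α : Type*} (c : α →₀ ZMod 2) : c + c = 0 := by
  ext a
  simp [CharTwo.add_self_eq_zero]

open scoped Classical in
/-- The cone operator with apex `v`: a face not containing `v` is joined with `v`. -/
noncomputable def cone (v : V) : (Finset V →₀ ZMod 2) →ₗ[ZMod 2] (Finset V →₀ ZMod 2) :=
  Finsupp.linearCombination (ZMod 2) fun σ : Finset V =>
    if v ∈ σ then 0 else Finsupp.single (insert v σ) (1 : ZMod 2)

open scoped Classical in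
theorem cone_single (v : V) (σ : Finset V) :
    cone v (Finsupp.single σ (1 : ZMod 2)) =
      if v ∈ σ then 0 else Finsupp.single (insert v σ) (1 : ZMod 2) := by
  simp [cone]

/-- The cone is a contracting homotopy of the full augmented chain complex; only membership of the
cone in a given complex has to be checked later. -/
theorem boundary_cone_add_cone_boundary (v : V) (c : Finset V →₀ ZMod 2) :
    boundary (cone v c) + cone v (boundary c) = c := by
  classical
  suffices h : boundary ∘ₗ cone v + cone v ∘ₗ boundary = LinearMap.id (R := ZMod 2) from
    LinearMap.congr_fun h c
  refine Finsupp.lhom_ext' fun σ => LinearMap.ext_ring ?_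
  simp only [LinearMap.comp_apply, Finsupp.lsingle_apply, LinearMap.add_apply, LinearMap.id_apply]
  rw [boundary_single, map_sum, cone_single]
  simp only [cone_single]
  by_cases hv : v ∈ σ
  · rw [if_pos hv, map_zero, zero_add, Finset.sum_eq_single v]
    · simp [hv]
    · intro u _ huv
      rw [if_pos (by simp [hv, huv.symm])]
    · exact fun h => absurd hv h
  · rw [if_neg hv, boundary_single, Finset.sum_insert hv, Finset.erase_insert hv, add_assoc,
      ← Finset.sum_add_distrib, Finset.sum_eq_zero, add_zero]
    intro u hu
    have huv : v ≠ u := fun h => hv (h ▸ hu)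
    rw [if_neg (by simp [hv]), Finset.erase_insert_of_ne huv]
    exact add_self_chain _

open scoped Classical in
/-- The operator that sends a face `σ ⊇ e` to `σ \ e` and all other faces to `0`. -/
noncomputable def contract (e : Finset V) :
    (Finset V →₀ ZMod 2) →ₗ[ZMod 2] (Finset V →₀ ZMod 2) :=
  Finsupp.linearCombination (ZMod 2) fun σ : Finset V =>
    if e ⊆ σ then Finsupp.single (σ \ e) (1 : ZMod 2) else 0

open scoped Classical in
theorem contract_single (e σ : Finset V) :
    contract e (Finsupp.single σ (1 : ZMod 2)) =
      if e ⊆ σ then Finsupp.single (σ \ e) (1 : ZMod 2) else 0 := by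
  simp [contract]

/-- Deleting a vertex of `e` leaves a face that no longer contains `e`, so only the vertices of `σ \
e` contribute on the left. -/
theorem contract_boundary (e : Finset V) (c : Finset V →₀ ZMod 2) :
    contract e (boundary c) = boundary (contract e c) := by
  classical
  suffices h : contract e ∘ₗ boundary = boundary ∘ₗ contract e from LinearMap.congr_fun h c
  refine Finsupp.lhom_ext' fun σ => LinearMap.ext_ring ?_
  simp only [LinearMap.comp_apply, Finsupp.lsingle_apply]
  rw [boundary_single, map_sum, contract_single]
  simp only [contract_single]
  split_ifs with h
  · rw [boundary_single, ← Finset.sum_subset (Finset.sdiff_subset (s := σ) (t := e))]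
    · refine Finset.sum_congr rfl fun v hv => ?_
      rw [Finset.mem_sdiff] at hv
      rw [if_pos (Finset.subset_erase.2 ⟨h, hv.2⟩), Finset.erase_sdiff_comm]
    · intro v hv hv'
      rw [if_neg]
      intro h'
      rw [Finset.mem_sdiff] at hv'
      exact (Finset.subset_erase.1 h').2 (by tauto)
  · rw [map_zero]
    refine Finset.sum_eq_zero fun v _ => if_neg fun h' => h (h'.trans (Finset.erase_subset _ _))

open scoped Classical in
theorem contract_apply {e η : Finset V} (h : Disjoint e η) (c : Finset V →₀ ZMod 2) :
    contract e c η = c (e ∪ η) := by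
  suffices h : Finsupp.lapply η ∘ₗ contract e = Finsupp.lapply (R := ZMod 2) (e ∪ η) from
    LinearMap.congr_fun h c
  refine Finsupp.lhom_ext' fun σ => LinearMap.ext_ring ?_
  simp only [LinearMap.comp_apply, Finsupp.lsingle_apply, Finsupp.lapply_apply, contract_single]
  split_ifs with h'
  · rw [Finsupp.single_apply, Finsupp.single_apply]
    refine if_congr ⟨?_, ?_⟩ rfl rfl
    · rintro rfl
      exact (Finset.union_sdiff_of_subset h').symm
    · rintro rfl
      exact Finset.union_sdiff_cancel_left h
  · rw [Finsupp.single_apply, if_neg, Finsupp.zero_apply]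
    rintro rfl
    exact h' Finset.subset_union_left

open scoped Classical in
/-- The join of all faces with `e`. -/
noncomputable def join (e : Finset V) :
    (Finset V →₀ ZMod 2) →ₗ[ZMod 2] (Finset V →₀ ZMod 2) :=
  Finsupp.lmapDomain (ZMod 2) (ZMod 2) fun σ : Finset V => e ∪ σ

open scoped Classical in
theorem join_single (e σ : Finset V) :
    join e (Finsupp.single σ (1 : ZMod 2)) = Finsupp.single (e ∪ σ) 1 := by
  simp [join]

theorem contract_join {e : Finset V} {c : Finset V →₀ ZMod 2}
    (hc : c ∈ Finsupp.supported (ZMod 2) (ZMod 2) {σ | Disjoint e σ}) :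
    contract e (join e c) = c := by
  classical
  have := map_mem_of_mem_supported (N := ⊥) (contract e ∘ₗ join e - LinearMap.id) ?_ hc
  · simpa [sub_eq_zero] using this
  · intro σ hσ
    simp only [LinearMap.sub_apply, LinearMap.comp_apply, LinearMap.id_apply, Submodule.mem_bot]
    rw [join_single, contract_single, if_pos Finset.subset_union_left,
      Finset.union_sdiff_cancel_left hσ, sub_self]

theorem chains_mono {K K' : LowerSet (Finset V)} (h : K ≤ K') (i : ℤ) : chains K i ≤ chains K' i :=
  Finsupp.supported_mono fun _ hσ => ⟨h hσ.1, hσ.2⟩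

theorem boundary_mem_chains {K : LowerSet (Finset V)} {i : ℤ} {c : Finset V →₀ ZMod 2}
    (hc : c ∈ chains K (i + 1)) : boundary c ∈ chains K i :=
  (boundaries_le_cycles K i ⟨c, hc, rfl⟩).1

theorem mem_of_mem_chains {K : LowerSet (Finset V)} {i : ℤ} {c : Finset V →₀ ZMod 2}
    (hc : c ∈ chains K i) {σ : Finset V} (hσ : c σ ≠ 0) : σ ∈ K ∧ (σ.card : ℤ) = i + 1 :=
  hc (Finsupp.mem_support_iff.2 hσ)

theorem chains_eq_bot_of_lt (K : LowerSet (Finset V)) {i : ℤ} (hi : i < -1) : chains K i = ⊥ := by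
  rw [chains, ← Finsupp.supported_empty]
  congr 1
  ext σ
  simp only [Set.mem_ofPred_eq, Set.mem_empty_iff_false, iff_false, not_and]
  intro _ h
  omega

end ChainOperators

/-! ### Acyclicity of complexes defined by forbidden sets. -/

section Forbidden

variable {V : Type*}

open scoped Classical in
/-- The link of `ρ` in the complex of all subsets of `W` that contain no member of `F`. -/
def forbiddenLink (W : Finset V) (F : Finset (Finset V)) (ρ : Finset V) : LowerSet (Finset V) where
  carrier := {σ | σ ⊆ W ∧ Disjoint σ ρ ∧ ∀ f ∈ F, ¬ f ⊆ σ ∪ ρ}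
  lower' := by
    rintro σ τ hτ ⟨h1, h2, h3⟩
    exact ⟨le_trans hτ h1, h2.mono_left hτ,
      fun f hf h => h3 f hf (h.trans (Finset.union_subset_union_left hτ))⟩

open scoped Classical in
theorem mem_forbiddenLink {W : Finset V} {F : Finset (Finset V)} {ρ σ : Finset V} :
    σ ∈ forbiddenLink W F ρ ↔ σ ⊆ W ∧ Disjoint σ ρ ∧ ∀ f ∈ F, ¬ f ⊆ σ ∪ ρ :=
  Iff.rfl

theorem mem_forbiddenLink_empty {W : Finset V} {F : Finset (Finset V)} {σ : Finset V} :
    σ ∈ forbiddenLink W F ∅ ↔ σ ⊆ W ∧ ∀ f ∈ F, ¬ f ⊆ σ := by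
  classical
  rw [mem_forbiddenLink, Finset.union_empty]
  exact and_congr_right fun _ => and_iff_right (Finset.disjoint_empty_right _)

/-- Acyclicity passes from a complex with one forbidden set less, if the corresponding link
is acyclic in the appropriate dimension. -/
theorem cycles_le_boundaries_of_erase {K K' L : LowerSet (Finset V)} {e : Finset V} {i : ℤ}
    (hK : ∀ σ, σ ∈ K ↔ σ ∈ K' ∧ ¬ e ⊆ σ)
    (hL : open scoped Classical in ∀ σ, σ ∈ L ↔ Disjoint e σ ∧ e ∪ σ ∈ K')
    (h1 : cycles K' i ≤ boundaries K' i)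
    (h2 : cycles L (i + 1 - e.card) ≤ boundaries L (i + 1 - e.card)) :
    cycles K i ≤ boundaries K i := by
  classical
  rintro z ⟨hz, hz0⟩
  have hKK' : K ≤ K' := fun σ hσ => ((hK σ).1 hσ).1
  obtain ⟨c, hc, rfl⟩ := h1 ⟨chains_mono hKK' i hz, hz0⟩
  -- Contraction identifies chains of the pair `(K', K)` with chains of the link `L`; as `z` lives
  -- in `K`, `c` is a relative cycle.
  have hy : contract e c ∈ chains L (i + 1 - e.card) := by
    refine map_mem_of_mem_supported (contract e) ?_ hc
    rintro σ ⟨hσ, hcard⟩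
    rw [contract_single]
    split_ifs with h
    · refine Finsupp.single_mem_supported _ _ ⟨(hL _).2 ⟨Finset.disjoint_sdiff, ?_⟩, ?_⟩
      · rwa [Finset.union_sdiff_of_subset h]
      · rw [Finset.card_sdiff_of_subset h, Nat.cast_sub (Finset.card_le_card h)]
        omega
    · exact Submodule.zero_mem _
  have hy0 : boundary (contract e c) = 0 := by
    rw [← contract_boundary]
    have := map_mem_of_mem_supported (N := ⊥) (contract e) ?_ hz
    · simpa using this
    · rintro σ ⟨hσ, -⟩
      rw [contract_single, if_neg ((hK σ).1 hσ).2]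
      exact Submodule.zero_mem _
  obtain ⟨w, hw, hwy⟩ := h2 ⟨hy, hy0⟩
  have hjw : join e w ∈ chains K' (i + 1 + 1) := by
    refine map_mem_of_mem_supported (join e) ?_ hw
    rintro σ ⟨hσ, hcard⟩
    obtain ⟨hd, hσ'⟩ := (hL σ).1 hσ
    rw [join_single]
    refine Finsupp.single_mem_supported _ _ ⟨hσ', ?_⟩
    rw [Finset.card_union_of_disjoint hd]
    push_cast
    omega
  have hcj : contract e (join e w) = w :=
    contract_join (Finsupp.supported_mono (fun σ hσ => ((hL σ).1 hσ.1).1) hw)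
  -- This correction keeps the boundary `z` and cancels every face containing `e`.
  have hc' : c + boundary (join e w) ∈ chains K' (i + 1) :=
    Submodule.add_mem _ hc (boundary_mem_chains hjw)
  have h0 : contract e (c + boundary (join e w)) = 0 := by
    rw [map_add, contract_boundary, hcj, hwy, add_self_chain]
  refine ⟨c + boundary (join e w), ?_, ?_⟩
  · intro σ hσ
    obtain ⟨hσK, hcard⟩ := hc' hσ
    refine ⟨(hK σ).2 ⟨hσK, fun he => Finsupp.mem_support_iff.1 hσ ?_⟩, hcard⟩
    rw [← Finset.union_sdiff_of_subset he, ← contract_apply Finset.disjoint_sdiff, h0,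
      Finsupp.zero_apply]
  · rw [map_add, boundary_boundary, add_zero]

theorem cycles_le_boundaries_of_cone {K : LowerSet (Finset V)} {v : V}
    (hv : open scoped Classical in ∀ σ ∈ K, insert v σ ∈ K) (i : ℤ) :
    cycles K i ≤ boundaries K i := by
  classical
  rintro z ⟨hz, hz0⟩
  refine ⟨cone v z, map_mem_of_mem_supported (cone v) ?_ hz, ?_⟩
  · rintro σ ⟨hσ, hcard⟩
    rw [cone_single]
    split_ifs with h
    · exact Submodule.zero_mem _
    · refine Finsupp.single_mem_supported _ _ ⟨hv σ hσ, ?_⟩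
      rw [Finset.card_insert_of_notMem h]
      push_cast
      omega
  · have := boundary_cone_add_cone_boundary v z
    rwa [LinearMap.mem_ker.1 hz0, map_zero, add_zero] at this

/-- If every small set `T` leaves a point `q` that completes no forbidden set together with
points of `T`, then the complex defined by the forbidden sets is acyclic in low dimensions. -/
theorem cycles_forbiddenLink_le_boundaries [inst : DecidableEq V] {W : Finset V}
    {F₀ : Finset (Finset V)} {k : ℕ} (hF₀ : ∀ f ∈ F₀, f ⊆ W)
    (H : ∀ T ⊆ W, T.card ≤ 2 * k + 2 → ∃ q ∈ W, q ∉ T ∧ ∀ f ∈ F₀, q ∈ f → ¬ f ⊆ insert q T)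
    (j : ℕ) (F : Finset (Finset V)) (hF : F ⊆ F₀) (i : ℤ) (hij : i + 2 ≤ j) (ρ : Finset V)
    (hρW : ρ ⊆ W) (hρ : ∀ f ∈ F, ¬ f ⊆ ρ) (hcard : ρ.card + 2 * i ≤ 2 * k) :
    cycles (forbiddenLink W F ρ) i ≤ boundaries (forbiddenLink W F ρ) i := by
  obtain rfl : inst = fun a b => Classical.propDecidable (a = b) := Subsingleton.elim _ _
  classical
  induction j using Nat.strong_induction_on generalizing F i ρ with
  | _ j ihj =>
  induction F using Finset.strongInduction with
  | H F ihF =>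
  rcases lt_or_ge i (-1) with hi | hi
  · rw [cycles, chains_eq_bot_of_lt _ hi, bot_inf_eq]
    exact bot_le
  -- Here `i ≥ -1` turns `hcard` into `|ρ| ≤ 2k + 2`.
  obtain ⟨q, hqW, hqρ, hq⟩ := H ρ hρW (by omega)
  by_cases hqF : ∃ f ∈ F, q ∈ f
  · obtain ⟨f, hf, hqf⟩ := hqF
    have hrec := ihF (F.erase f) (Finset.erase_ssubset hf) ((Finset.erase_subset _ _).trans hF)
      fun g hg => hρ g (Finset.mem_of_mem_erase hg)
    -- Such a `g` makes `f` redundant in the link of `ρ`; otherwise `ρ ∪ f` is an admissible new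
    -- `ρ`.
    by_cases hL : ∃ g ∈ F.erase f, g ⊆ ρ ∪ f
    · obtain ⟨g, hg, hgf⟩ := hL
      have : forbiddenLink W F ρ = forbiddenLink W (F.erase f) ρ := by
        refine SetLike.ext fun σ => ?_
        rw [mem_forbiddenLink, mem_forbiddenLink]
        refine ⟨fun h => ⟨h.1, h.2.1, fun a ha => h.2.2 a (Finset.mem_of_mem_erase ha)⟩,
          fun h => ⟨h.1, h.2.1, fun a ha haσ => ?_⟩⟩
        by_cases haf : a = f
        · subst haf
          exact h.2.2 g hg (hgf.trans (Finset.union_subset Finset.subset_union_right haσ))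
        · exact h.2.2 a (Finset.mem_erase.2 ⟨haf, ha⟩) haσ
      rw [this]
      exact hrec
    · push Not at hL
      -- By the choice of `q`, `f` has a vertex outside `ρ` other than `q`.
      have hcard2 : 2 ≤ (f \ ρ).card := by
        have hqe : q ∈ f \ ρ := Finset.mem_sdiff.2 ⟨hqf, hqρ⟩
        by_contra hlt
        have h1 : (f \ ρ).card ≤ 1 := by omega
        refine hq f (hF hf) hqf fun x hx => ?_
        by_cases hxρ : x ∈ ρ
        · exact Finset.mem_insert_of_mem hxρ
        · rw [Finset.card_le_one.1 h1 x (Finset.mem_sdiff.2 ⟨hx, hxρ⟩) q hqe]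
          exact Finset.mem_insert_self _ _
      have hρf : ρ ∪ f = ρ ∪ f \ ρ := Finset.union_sdiff_self_eq_union.symm
      have hfρ : f ⊆ ρ ∪ f \ ρ := hρf ▸ Finset.subset_union_right
      refine cycles_le_boundaries_of_erase (K' := forbiddenLink W (F.erase f) ρ)
        (L := forbiddenLink W (F.erase f) (ρ ∪ f)) (e := f \ ρ) ?_ ?_ hrec ?_
      · intro σ
        rw [mem_forbiddenLink, mem_forbiddenLink]
        have hfσ : f \ ρ ⊆ σ ↔ f ⊆ σ ∪ ρ := sdiff_le_iff'
        rw [hfσ]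
        refine ⟨fun h => ⟨⟨h.1, h.2.1, fun a ha => h.2.2 a (Finset.mem_of_mem_erase ha)⟩,
          h.2.2 f hf⟩, fun h => ⟨h.1.1, h.1.2.1, fun a ha haσ => ?_⟩⟩
        by_cases haf : a = f
        · subst haf
          exact h.2 haσ
        · exact h.1.2.2 a (Finset.mem_erase.2 ⟨haf, ha⟩) haσ
      · intro σ
        have hu : f \ ρ ∪ σ ∪ ρ = σ ∪ (ρ ∪ f) := by
          rw [hρf]
          ac_rfl
        rw [mem_forbiddenLink, mem_forbiddenLink, hu]
        constructor
        · rintro ⟨h1, h2, h3⟩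
          rw [Finset.disjoint_union_right] at h2
          refine ⟨(h2.2.mono_right Finset.sdiff_subset).symm, Finset.union_subset
            (Finset.sdiff_subset.trans (hF₀ f (hF hf))) h1, ?_, h3⟩
          rw [Finset.disjoint_union_left]
          exact ⟨Finset.sdiff_disjoint, h2.1⟩
        · rintro ⟨h0, h1, h2, h3⟩
          rw [Finset.disjoint_union_left] at h2
          refine ⟨Finset.subset_union_right.trans h1, ?_, h3⟩
          rw [hρf, Finset.disjoint_union_right]
          exact ⟨h2.2, h0.symm⟩
      · have hcu : (ρ ∪ f).card = ρ.card + (f \ ρ).card := by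
          rw [hρf, Finset.card_union_of_disjoint Finset.disjoint_sdiff]
        -- Passing to the link changes `|ρ| + 2i` by `2 - |f \ ρ| ≤ 0`, so the bound `2k` persists
        -- while the degree drops.
        refine ihj (j - 1) (by omega) (F.erase f) ((Finset.erase_subset _ _).trans hF) _ (by omega)
          _ (Finset.union_subset hρW (hF₀ f (hF hf))) hL ?_
        rw [hcu]
        push_cast
        omega
  · push Not at hqF
    refine cycles_le_boundaries_of_cone (v := q) ?_ i
    rintro σ ⟨h1, h2, h3⟩
    refine ⟨Finset.insert_subset hqW h1, Finset.disjoint_insert_left.2 ⟨hqρ, h2⟩,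
      fun f hf hfσ => h3 f hf fun x hx => ?_⟩
    have hxq : x ≠ q := fun h => hqF f hf (h ▸ hx)
    have := hfσ hx
    rw [Finset.insert_union, Finset.mem_insert] at this
    exact this.resolve_left hxq

end Forbidden

end GenPos

namespace GenPos

/-! ### Affine independence and avoidance of finitely many flats. -/

section AffineIndependence

variable {E : Type*} [AddCommGroup E] [Module ℝ E]

/-- Affine independence of a set of points. -/
abbrev AffIndep (s : Set E) : Prop :=
  AffineIndependent ℝ (fun x : s => (x : E))

theorem affIndep_insert {s : Set E} (hs : AffIndep s) {y : E} (hy : y ∉ affineSpan ℝ s) :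
    AffIndep (insert y s) := by
  have hys : y ∉ s := fun h => hy (subset_affineSpan ℝ s h)
  refine AffineIndependent.affineIndependent_of_notMem_span (i := ⟨y, Set.mem_insert y s⟩) ?_ ?_
  · have hmem : ∀ x : {x : ↥(insert y s) // x ≠ ⟨y, Set.mem_insert y s⟩}, (x.1 : E) ∈ s := by
      rintro ⟨⟨x, hx⟩, hne⟩
      exact hx.resolve_left fun h => hne (Subtype.ext h)
    exact hs.comp_embedding ⟨fun x => (⟨(x.1 : E), hmem x⟩ : s), fun a b h =>
      Subtype.ext (Subtype.ext (congrArg (fun z : s => (z : E)) h))⟩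
  · refine fun h => hy (affineSpan_mono ℝ ?_ h)
    rintro _ ⟨⟨x, hx⟩, hne, rfl⟩
    exact hx.resolve_left fun h => hne (Subtype.ext h)

theorem mem_affineSpan_of_not_affIndep_insert {s : Set E} (hs : AffIndep s) {y : E}
    (hy : ¬ AffIndep (insert y s)) : y ∈ affineSpan ℝ s :=
  by_contra fun h => hy (affIndep_insert hs h)

theorem not_affIndep_insert {s : Set E} {y : E} (hys : y ∉ s) (hy : y ∈ affineSpan ℝ s) :
    ¬ AffIndep (insert y s) := by
  intro h
  refine h.notMem_affineSpan_sdiff ⟨y, Set.mem_insert y s⟩ Set.univ (affineSpan_mono ℝ ?_ hy)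
  intro x hx
  exact ⟨⟨x, Set.mem_insert_of_mem y hx⟩, ⟨Set.mem_univ _, fun h => hys (by
    have : x = y := congrArg (fun z : ↥(insert y s) => (z : E)) h
    exact this ▸ hx)⟩, rfl⟩

theorem affIndep_empty : AffIndep (∅ : Set E) :=
  affineIndependent_of_subsingleton ℝ _

/-- An affine subspace is not covered by finitely many subspaces that do not contain it. -/
theorem exists_mem_forall_notMem_affineSubspace (s : AffineSubspace ℝ E) (hs : (s : Set E).Nonempty)
    (I : Finset (AffineSubspace ℝ E)) (hI : ∀ t ∈ I, ¬ s ≤ t) : ∃ x ∈ s, ∀ t ∈ I, x ∉ t := by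
  classical
  induction I using Finset.induction_on with
  | empty => exact ⟨hs.some, hs.some_mem, by simp⟩
  | insert t I _ ih =>
    obtain ⟨x, hx, hxI⟩ := ih fun u hu => hI u (Finset.mem_insert_of_mem hu)
    by_cases hxt : x ∈ t
    · obtain ⟨y, hy, hyt⟩ := Set.not_subset.1 (hI t (Finset.mem_insert_self _ _))
      -- A subspace containing two points of the line through `x` and `y` contains both `x` and `y`;
      -- so each subspace to be avoided excludes at most one parameter.
      have hline : ∀ u : AffineSubspace ℝ E, x ∉ u ∨ y ∉ u →
          {c : ℝ | AffineMap.lineMap x y c ∈ u}.Subsingleton := by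
        intro u hu a ha b hb
        by_contra hab
        have key : ∀ c : ℝ, AffineMap.lineMap x y c ∈ u := by
          intro c
          have := AffineMap.lineMap_mem (Q := u) ((c - a) / (b - a)) ha hb
          convert this using 1
          have hba : b - a ≠ 0 := sub_ne_zero.2 (Ne.symm hab)
          simp only [AffineMap.lineMap_apply_module']
          rw [add_sub_add_right_eq_sub, ← sub_smul, smul_smul, div_mul_cancel₀ _ hba, sub_smul]
          abel
        rcases hu with hu | hu
        · exact hu (by simpa using key 0)
        · exact hu (by simpa using key 1)
      have hfin : (⋃ u ∈ insert t I, {c : ℝ | AffineMap.lineMap x y c ∈ u}).Finite := by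
        refine Set.Finite.biUnion (Finset.finite_toSet _) fun u hu => (hline u ?_).finite
        rcases Finset.mem_insert.1 hu with rfl | hu
        · exact Or.inr hyt
        · exact Or.inl (hxI u hu)
      obtain ⟨c, hc⟩ := hfin.infinite_compl.nonempty
      refine ⟨AffineMap.lineMap x y c, AffineMap.lineMap_mem c hx hy, fun u hu hcu => hc ?_⟩
      exact Set.mem_biUnion hu hcu
    · refine ⟨x, hx, fun u hu => ?_⟩
      rcases Finset.mem_insert.1 hu with rfl | hu
      · exact hxt
      · exact hxI u hu

end AffineIndependence

/-! ### Existence of `A` and of a generic `B`. -/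

section Existence

variable {d : ℕ}

local notation "𝔼" => EuclideanSpace ℝ (Fin d)

theorem InGeneralPosition.affIndep {Q : Set 𝔼} (hQ : InGeneralPosition Q) {T : Finset 𝔼}
    (hT : (T : Set 𝔼) ⊆ Q) (hcard : T.card ≤ d + 1) : AffIndep (T : Set 𝔼) :=
  hQ T hT hcard

theorem not_top_le_affineSpan {T : Finset 𝔼} (hT : T.card ≤ d) :
    ¬ (⊤ : AffineSubspace ℝ 𝔼) ≤ affineSpan ℝ (T : Set 𝔼) := by
  intro h
  have h' := top_le_iff.1 h
  have h1 : vectorSpan ℝ (T : Set 𝔼) = ⊤ := by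
    rw [← direction_affineSpan, h', AffineSubspace.direction_top]
  rcases Nat.eq_zero_or_pos T.card with h0 | h0
  · rw [Finset.card_eq_zero.1 h0, Finset.coe_empty, AffineSubspace.span_empty] at h'
    exact AffineSubspace.bot_ne_top ℝ 𝔼 𝔼 h'
  · have h2 := finrank_vectorSpan_image_finset_le ℝ (id : 𝔼 → 𝔼) T (n := T.card - 1) (by omega)
    rw [Finset.image_id, h1, finrank_top, finrank_euclideanSpace_fin] at h2
    omega

theorem exists_inGeneralPosition {d : ℕ} (hd : 0 < d) (n : ℕ) :
    ∃ A : Finset (EuclideanSpace ℝ (Fin d)),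
      A.card = n ∧ InGeneralPosition (A : Set (EuclideanSpace ℝ (Fin d))) := by
  classical
  induction n with
  | zero =>
    refine ⟨∅, rfl, fun T hT _ => ?_⟩
    rw [Finset.coe_empty, Set.subset_empty_iff] at hT
    change AffIndep (T : Set (EuclideanSpace ℝ (Fin d)))
    rw [hT]
    exact affIndep_empty
  | succ n ih =>
    obtain ⟨A, rfl, hA⟩ := ih
    obtain ⟨y, -, hy⟩ := exists_mem_forall_notMem_affineSubspace
      (⊤ : AffineSubspace ℝ (EuclideanSpace ℝ (Fin d))) ⟨0, trivial⟩
      ((A.powerset.filter fun T => T.card ≤ d).image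
        fun T : Finset _ => affineSpan ℝ (T : Set (EuclideanSpace ℝ (Fin d)))) (by
        intro t ht
        obtain ⟨T, hT, rfl⟩ := Finset.mem_image.1 ht
        exact not_top_le_affineSpan (Finset.mem_filter.1 hT).2)
    have hy' : ∀ T ⊆ A, T.card ≤ d → y ∉ affineSpan ℝ (T : Set (EuclideanSpace ℝ (Fin d))) :=
      fun T hT hc => hy _ (Finset.mem_image_of_mem _
        (Finset.mem_filter.2 ⟨Finset.mem_powerset.2 hT, hc⟩))
    have hyA : y ∉ A := fun h => hy' {y} (Finset.singleton_subset_iff.2 h)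
      (by rwa [Finset.card_singleton]) (subset_affineSpan _ _ (by simp))
    refine ⟨insert y A, Finset.card_insert_of_notMem hyA, fun T hT hc => ?_⟩
    rw [Finset.coe_subset] at hT
    change AffIndep (T : Set (EuclideanSpace ℝ (Fin d)))
    by_cases hyT : y ∈ T
    · have hT' : T.erase y ⊆ A := Finset.subset_insert_iff.1 hT
      have hcard : (T.erase y).card ≤ d := by
        rw [Finset.card_erase_of_mem hyT]
        omega
      rw [← Finset.insert_erase hyT, Finset.coe_insert]
      exact affIndep_insert (hA.affIndep (Finset.coe_subset.2 hT') (by omega)) (hy' _ hT' hcard)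
    · exact hA T (Finset.coe_subset.2 ((Finset.subset_insert_iff_of_notMem hyT).1 hT)) hc

-- The points are chosen one hyperplane at a time, each off all flats spanned by at most `d` earlier
-- points except the prescribed one. The crux is that no such flat contains the prescribed
-- hyperplane.
open scoped Classical in
theorem exists_generic_points (hd : 2 ≤ d) {A : Finset 𝔼} (hA : InGeneralPosition (A : Set 𝔼))
    (F : Finset (Finset 𝔼)) (hF : ∀ S ∈ F, S ⊆ A ∧ S.card = d) :
    ∃ x : Finset 𝔼 → 𝔼, (∀ S ∈ F, x S ∈ affineSpan ℝ (S : Set 𝔼)) ∧ (∀ S ∈ F, x S ∉ A) ∧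
      (∀ S ∈ F, ∀ S' ∈ F, x S = x S' → S = S') ∧
      ∀ T : Finset 𝔼, T ⊆ A ∪ F.image x → T.card ≤ d + 1 → ¬ AffIndep (T : Set 𝔼) →
        ∃ S ∈ F, T = insert (x S) S := by
  induction F using Finset.induction_on with
  | empty =>
    refine ⟨fun _ => 0, by simp, by simp, by simp, fun T hT hc h => absurd ?_ h⟩
    exact hA T (by simpa using hT) hc
  | insert S F hSF ih =>
    obtain ⟨x, hx1, hx2, hx3, hx4⟩ := ih fun S' hS' => hF S' (Finset.mem_insert_of_mem hS')
    obtain ⟨hSA, hSd⟩ := hF S (Finset.mem_insert_self _ _)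
    have hF' : ∀ S' ∈ F, S' ⊆ A ∧ S'.card = d := fun S' hS' => hF S' (Finset.mem_insert_of_mem hS')
    have hSne : (S : Set 𝔼).Nonempty := by
      rw [Finset.coe_nonempty, ← Finset.card_pos]
      omega
    have hSind : AffIndep (S : Set 𝔼) := hA.affIndep (Finset.coe_subset.2 hSA) (by omega)
    obtain ⟨y, hyS, hy⟩ := exists_mem_forall_notMem_affineSubspace
      (affineSpan ℝ (S : Set 𝔼)) ((affineSpan_nonempty ℝ).2 hSne)
      (((A ∪ F.image x).powerset.filter fun T => T.card ≤ d ∧ T ≠ S).image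
        fun T : Finset _ => affineSpan ℝ (T : Set 𝔼)) (by
        intro t ht hle
        obtain ⟨T, hT, rfl⟩ := Finset.mem_image.1 ht
        obtain ⟨hTsub, hTd, hTS⟩ := Finset.mem_filter.1 hT
        rw [Finset.mem_powerset] at hTsub
        have hST : (S : Set 𝔼) ⊆ affineSpan ℝ (T : Set 𝔼) :=
          (subset_affineSpan ℝ _).trans hle
        have hcard : S.card ≤ T.card :=
          AffineIndependent.card_le_card_of_subset_affineSpan hSind hST
        -- If `span T` contained `S`, adding any `s ∈ S \ T` to `T` would give a dependent set of
        -- the known form. Two suitable choices of `s` share the point `x S' ∈ T`, hence the same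
        -- `S'`, although the second choice avoids `S'`.
        have hadd : ∀ s ∈ S, s ∉ T → ∃ S' ∈ F, insert s T = insert (x S') S' := by
          intro s hs hsT
          refine hx4 _ (Finset.insert_subset (Finset.mem_union_left _ (hSA hs)) hTsub)
            ((Finset.card_insert_le _ _).trans (by omega)) ?_
          rw [Finset.coe_insert]
          exact not_affIndep_insert (by simpa using hsT) (hST hs)
        obtain ⟨s, hs, hsT⟩ : ∃ s ∈ S, s ∉ T := by
          by_contra! hcon
          exact hTS (Finset.eq_of_subset_of_card_le hcon (by omega)).symm
        obtain ⟨S', hS', h'⟩ := hadd s hs hsT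
        obtain ⟨s₂, hs₂, hs₂S'⟩ : ∃ s₂ ∈ S, s₂ ∉ S' := by
          by_contra! hcon
          refine hSF ?_
          rw [Finset.eq_of_subset_of_card_le hcon (by rw [(hF' S' hS').2, hSd])]
          exact hS'
        have hmem : ∀ {a}, a ∈ A → ∀ {R}, R ∈ F → a ∈ insert (x R) R → a ∈ R := by
          intro a ha R hR haR
          exact (Finset.mem_insert.1 haR).resolve_left fun h => hx2 R hR (h ▸ ha)
        have hs₂T : s₂ ∉ T := fun h =>
          hs₂S' (hmem (hSA hs₂) hS' (h' ▸ Finset.mem_insert_of_mem h))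
        obtain ⟨S'', hS'', h''⟩ := hadd s₂ hs₂ hs₂T
        have hxT : x S' ∈ T := by
          have : x S' ∈ insert s T := h' ▸ Finset.mem_insert_self _ _
          exact (Finset.mem_insert.1 this).resolve_left fun h => hx2 S' hS' (h ▸ hSA hs)
        have hxS'' : x S' ∈ insert (x S'') S'' := h'' ▸ Finset.mem_insert_of_mem hxT
        have heq : S' = S'' := by
          refine hx3 S' hS' S'' hS'' ((Finset.mem_insert.1 hxS'').resolve_right fun h => ?_)
          exact hx2 S' hS' ((hF' S'' hS'').1 h)
        rw [← heq] at h''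
        exact hs₂S' (hmem (hSA hs₂) hS' (h'' ▸ Finset.mem_insert_self _ _)))
    have hy' : ∀ T ⊆ A ∪ F.image x, T.card ≤ d → y ∈ affineSpan ℝ (T : Set 𝔼) → T = S := by
      intro T hT hc hyT
      by_contra hne
      exact hy _ (Finset.mem_image_of_mem _
        (Finset.mem_filter.2 ⟨Finset.mem_powerset.2 hT, hc, hne⟩)) hyT
    -- Here `d ≥ 2` matters: a singleton is smaller than `S`, so its span is among the avoided
    -- flats.
    have hynot : y ∉ A ∪ F.image x := by
      intro h
      have h1 := hy' {y} (Finset.singleton_subset_iff.2 h) (by simp; omega)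
        (subset_affineSpan _ _ (by simp))
      rw [← h1, Finset.card_singleton] at hSd
      omega
    have hne : ∀ S' ∈ F, S' ≠ S := fun S' hS' h => hSF (h ▸ hS')
    have hupd : ∀ S' ∈ F, Function.update x S y S' = x S' := fun S' hS' =>
      Function.update_of_ne (hne S' hS') _ _
    have hyx : ∀ S' ∈ F, y ≠ x S' := fun S' hS' h =>
      hynot (Finset.mem_union_right _ (h ▸ Finset.mem_image_of_mem _ hS'))
    have himage : (insert S F).image (Function.update x S y) = insert y (F.image x) := by
      rw [Finset.image_insert, Function.update_self]
      congr 1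
      exact Finset.image_congr fun S' hS' => hupd S' hS'
    refine ⟨Function.update x S y, ?_, ?_, ?_, ?_⟩
    · intro S' hS'
      rcases Finset.mem_insert.1 hS' with rfl | hS'
      · rwa [Function.update_self]
      · rw [hupd S' hS']
        exact hx1 S' hS'
    · intro S' hS'
      rcases Finset.mem_insert.1 hS' with rfl | hS'
      · rw [Function.update_self]
        exact fun h => hynot (Finset.mem_union_left _ h)
      · rw [hupd S' hS']
        exact hx2 S' hS'
    · intro S₁ h₁ S₂ h₂ h
      rcases Finset.mem_insert.1 h₁ with rfl | k₁ <;> rcases Finset.mem_insert.1 h₂ with rfl | k₂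
      · rfl
      · rw [Function.update_self, hupd _ k₂] at h
        exact absurd h (hyx _ k₂)
      · rw [Function.update_self, hupd _ k₁] at h
        exact absurd h.symm (hyx _ k₁)
      · rw [hupd _ k₁, hupd _ k₂] at h
        exact hx3 _ k₁ _ k₂ h
    · intro T hT hc hdep
      rw [himage, Finset.union_insert] at hT
      by_cases hyT : y ∈ T
      · have hT' : T.erase y ⊆ A ∪ F.image x := Finset.subset_insert_iff.1 hT
        have hcard := Finset.card_erase_add_one hyT
        refine ⟨S, Finset.mem_insert_self _ _, ?_⟩
        -- Dependent sets among the earlier points have exactly `d + 1` elements, too many for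
        -- `T.erase y`.
        have hind : AffIndep ((T.erase y : Finset 𝔼) : Set 𝔼) := by
          by_contra hcon
          obtain ⟨S', hS', h'⟩ := hx4 _ hT' (by omega) hcon
          rw [h', Finset.card_insert_of_notMem fun h => hx2 S' hS' ((hF' S' hS').1 h),
            (hF' S' hS').2] at hcard
          omega
        rw [← Finset.insert_erase hyT, Finset.coe_insert] at hdep
        rw [Function.update_self, ← hy' _ hT' (by omega)
          (mem_affineSpan_of_not_affIndep_insert hind hdep), Finset.insert_erase hyT]
      · obtain ⟨S', hS', h'⟩ :=
          hx4 T ((Finset.subset_insert_iff_of_notMem hyT).1 hT) hc hdep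
        exact ⟨S', Finset.mem_insert_of_mem hS', by rw [hupd S' hS', h']⟩

theorem exists_isGenericTransversal (hd : 2 ≤ d) {A : Finset 𝔼}
    (hA : InGeneralPosition (A : Set 𝔼)) : ∃ B : Finset 𝔼, IsGenericTransversal A B := by
  classical
  have hF : ∀ S ∈ A.powersetCard d, S ⊆ A ∧ S.card = d := fun S hS => Finset.mem_powersetCard.1 hS
  have hF' : ∀ S, S ⊆ A → S.card = d → S ∈ A.powersetCard d :=
    fun S h1 h2 => Finset.mem_powersetCard.2 ⟨h1, h2⟩
  obtain ⟨x, hx1, hx2, hx3, hx4⟩ := exists_generic_points hd hA (A.powersetCard d) hF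
  have hsep : ∀ S ∈ A.powersetCard d, ∀ S' ∈ A.powersetCard d,
      x S ∈ affineSpan ℝ (S' : Set 𝔼) → S = S' := by
    intro S hS S' hS' h
    have hnot : x S ∉ S' := fun h' => hx2 S hS ((hF S' hS').1 h')
    obtain ⟨R, hR, h'⟩ := hx4 (insert (x S) S')
      (Finset.insert_subset (Finset.mem_union_right _ (Finset.mem_image_of_mem _ hS))
        ((hF S' hS').1.trans Finset.subset_union_left))
      (by rw [Finset.card_insert_of_notMem hnot, (hF S' hS').2]) (by
        rw [Finset.coe_insert]
        exact not_affIndep_insert (by simpa using hnot) h)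
    have h1 : x S ∈ insert (x R) R := h' ▸ Finset.mem_insert_self _ _
    have hSR : S = R := hx3 S hS R hR
      ((Finset.mem_insert.1 h1).resolve_right fun h => hx2 S hS ((hF R hR).1 h))
    subst hSR
    have h2 : x S ∉ S := fun h' => hx2 S hS ((hF S hS).1 h')
    rw [← Finset.erase_insert h2, ← h', Finset.erase_insert hnot]
  refine ⟨(A.powersetCard d).image x, ?_, ?_, ?_, ?_, ?_, ?_⟩
  · rw [Finset.card_image_of_injOn fun S hS S' hS' h => hx3 S hS S' hS' h,
      Finset.card_powersetCard]
  · intro T hT hc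
    by_contra hdep
    rw [Finset.coe_subset] at hT
    obtain ⟨S, hS, h⟩ := hx4 T (hT.trans Finset.subset_union_right) hc hdep
    obtain ⟨s, hs⟩ : S.Nonempty := by
      rw [← Finset.card_pos, (hF S hS).2]
      omega
    obtain ⟨S', hS', h'⟩ := Finset.mem_image.1 (hT (h ▸ Finset.mem_insert_of_mem hs))
    exact hx2 S' hS' (h' ▸ (hF S hS).1 hs)
  · rw [Finset.disjoint_left]
    intro a ha ha'
    obtain ⟨S', hS', h'⟩ := Finset.mem_image.1 ha'
    exact hx2 S' hS' (h' ▸ ha)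
  · intro S hS hSd
    rw [Set.ncard_eq_one]
    refine ⟨x S, Set.eq_singleton_iff_unique_mem.2
      ⟨⟨Finset.mem_image_of_mem _ (hF' S hS hSd), hx1 S (hF' S hS hSd)⟩, ?_⟩⟩
    rintro y ⟨hy, hyS⟩
    obtain ⟨S', hS', rfl⟩ := Finset.mem_image.1 hy
    rw [hsep S' hS' S (hF' S hS hSd) hyS]
  · intro S hS hSd S' hS' hSd' y hy h h'
    obtain ⟨R, hR, rfl⟩ := Finset.mem_image.1 hy
    rw [← hsep R hR S (hF' S hS hSd) h, ← hsep R hR S' (hF' S' hS' hSd') h']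
  · intro T hT hc hdep
    rw [← Finset.coe_union, Finset.coe_subset] at hT
    obtain ⟨S, hS, h⟩ := hx4 T hT hc hdep
    exact ⟨S, (hF S hS).1, (hF S hS).2, x S, Finset.mem_image_of_mem _ hS, hx1 S hS, by
      rw [h, Finset.coe_insert]⟩

end Existence

end GenPos

namespace GenPos

/-! ### Cones varying with the trace on `A`, and adding a facet. -/

section FiberwiseCone

variable {V : Type*}

/-- Deleting a vertex outside `A` does not change the apex, so the two terms cancel mod 2; deleting
one in `A` shrinks the trace, and an apex outside `A` does not restore it. -/
theorem single_add_boundary_cone_mem {K : LowerSet (Finset V)} {A σ : Finset V} {b : Finset V → V}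
    (hbA : open scoped Classical in ∀ σ ∈ K, b (σ ∩ A) ∉ A)
    (hb : open scoped Classical in ∀ σ ∈ K, insert (b (σ ∩ A)) σ ∈ K) {i : ℤ} {m : ℕ}
    (hσK : σ ∈ K) (hσi : (σ.card : ℤ) = i + 1)
    (hσm : open scoped Classical in (σ ∩ A).card < m + 1) :
    open scoped Classical in
    cone (b (σ ∩ A)) (boundary (Finsupp.single σ 1)) +
      Finsupp.linearCombination (ZMod 2)
        (fun τ : Finset V => cone (b (τ ∩ A)) (Finsupp.single τ (1 : ZMod 2)))
        (boundary (Finsupp.single σ 1)) ∈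
    Finsupp.supported (ZMod 2) (ZMod 2)
      {τ : Finset V | τ ∈ K ∧ (τ.card : ℤ) = i + 1 ∧ (τ ∩ A).card < m} := by
  classical
  rw [boundary_single, map_sum, map_sum, ← Finset.sum_add_distrib]
  refine Submodule.sum_mem _ fun u hu => ?_
  rw [Finsupp.linearCombination_single, one_smul]
  have huK : σ.erase u ∈ K := K.lower (Finset.erase_subset u σ) hσK
  by_cases huA : u ∈ A
  · have key : ∀ v, v ∉ A → insert v (σ.erase u) ∈ K →
        cone v (Finsupp.single (σ.erase u) (1 : ZMod 2)) ∈
        Finsupp.supported (ZMod 2) (ZMod 2)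
          {τ : Finset V | τ ∈ K ∧ (τ.card : ℤ) = i + 1 ∧ (τ ∩ A).card < m} := by
      intro v hvA hvK
      rw [cone_single]
      split_ifs with hv
      · exact Submodule.zero_mem _
      refine Finsupp.single_mem_supported _ _ ⟨hvK, ?_, ?_⟩
      · rw [Finset.card_insert_of_notMem hv, Finset.card_erase_add_one hu, hσi]
      · rw [Finset.insert_inter_of_notMem hvA, Finset.erase_inter, Finset.card_erase_of_mem
          (Finset.mem_inter.2 ⟨hu, huA⟩)]
        have : 0 < (σ ∩ A).card := Finset.card_pos.2 ⟨u, Finset.mem_inter.2 ⟨hu, huA⟩⟩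
        omega
    refine Submodule.add_mem _ (key _ (hbA σ hσK) ?_) (key _ (hbA _ huK) (hb _ huK))
    exact K.lower (Finset.insert_subset_insert _ (Finset.erase_subset u σ)) (hb σ hσK)
  · have : σ.erase u ∩ A = σ ∩ A := by
      rw [Finset.erase_inter, Finset.erase_eq_of_notMem]
      exact fun h => huA (Finset.mem_inter.1 h).2
    rw [this, add_self_chain]
    exact Submodule.zero_mem _

/-- A complex is acyclic if the faces with a given trace on `A` always form a cone with an apex
outside `A`. -/
theorem cycles_le_boundaries_of_fiberwise_cone [inst : DecidableEq V] {K : LowerSet (Finset V)}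
    {A : Finset V} {b : Finset V → V} (hbA : ∀ σ ∈ K, b (σ ∩ A) ∉ A)
    (hb : ∀ σ ∈ K, insert (b (σ ∩ A)) σ ∈ K) (i : ℤ) : cycles K i ≤ boundaries K i := by
  obtain rfl : inst = fun a b => Classical.propDecidable (a = b) := Subsingleton.elim _ _
  classical
  suffices h : ∀ m : ℕ, ∀ z ∈ Finsupp.supported (ZMod 2) (ZMod 2)
      {τ : Finset V | τ ∈ K ∧ (τ.card : ℤ) = i + 1 ∧ (τ ∩ A).card < m},
      boundary z = 0 → z ∈ boundaries K i by
    rintro z ⟨hz, hz0⟩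
    refine h (A.card + 1) z (Finsupp.supported_mono ?_ hz) hz0
    exact fun τ hτ => ⟨hτ.1, hτ.2,
      Nat.lt_succ_of_le (Finset.card_le_card Finset.inter_subset_right)⟩
  intro m
  induction m with
  | zero =>
    intro z hz _
    have : z = 0 := by
      rw [← Finsupp.support_eq_empty, Finset.eq_empty_iff_forall_notMem]
      exact fun τ hτ => absurd (hz hτ).2.2 (Nat.not_lt_zero _)
    rw [this]
    exact Submodule.zero_mem _
  | succ m ih =>
    intro z hz hz0
    set h : (Finset V →₀ ZMod 2) →ₗ[ZMod 2] (Finset V →₀ ZMod 2) :=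
      Finsupp.linearCombination (ZMod 2)
        (fun τ : Finset V => cone (b (τ ∩ A)) (Finsupp.single τ (1 : ZMod 2))) with hh
    have h1 : h z ∈ chains K (i + 1) := by
      refine map_mem_of_mem_supported h ?_ hz
      rintro σ ⟨hσ, hσi, -⟩
      rw [hh, Finsupp.linearCombination_single, one_smul, cone_single]
      split_ifs with hv
      · exact Submodule.zero_mem _
      · refine Finsupp.single_mem_supported _ _ ⟨hb σ hσ, ?_⟩
        rw [Finset.card_insert_of_notMem hv]
        push_cast
        omega
    -- The map `id + ∂h + h∂` lowers the trace filtration, and on cycles it changes `z` only by a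
    -- boundary.
    have h2 : z + boundary (h z) ∈ Finsupp.supported (ZMod 2) (ZMod 2)
        {τ : Finset V | τ ∈ K ∧ (τ.card : ℤ) = i + 1 ∧ (τ ∩ A).card < m} := by
      have := map_mem_of_mem_supported
        (N := Finsupp.supported (ZMod 2) (ZMod 2)
          {τ : Finset V | τ ∈ K ∧ (τ.card : ℤ) = i + 1 ∧ (τ ∩ A).card < m})
        (LinearMap.id + boundary ∘ₗ h + h ∘ₗ boundary) ?_ hz
      · simpa [hz0] using this
      · rintro σ ⟨hσ, hσi, hσm⟩
        convert single_add_boundary_cone_mem hbA hb hσ hσi hσm using 1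
        simp only [LinearMap.add_apply, LinearMap.comp_apply, LinearMap.id_apply]
        rw [← hh]
        congr 1
        rw [hh, Finsupp.linearCombination_single, one_smul]
        nth_rewrite 1 [← boundary_cone_add_cone_boundary (b (σ ∩ A)) (Finsupp.single σ 1)]
        rw [add_right_comm, add_self_chain, zero_add]
    obtain ⟨w, hw, hwz⟩ := ih _ h2 (by rw [map_add, hz0, boundary_boundary, add_zero])
    refine ⟨w + h z, Submodule.add_mem _ hw h1, ?_⟩
    rw [map_add, hwz, add_assoc, add_self_chain, add_zero]

/-- Adding a facet `A` to an acyclic complex produces homology in the dimension of `A` only. -/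
theorem cycles_le_boundaries_iff_of_facet {K K' : LowerSet (Finset V)} {A : Finset V}
    (hK : ∀ σ, σ ∈ K' ↔ σ ∈ K ∧ σ ≠ A) (hA : A ∈ K) (hmax : ∀ σ ∈ K, A ⊆ σ → σ = A)
    (hK' : ∀ i, cycles K' i ≤ boundaries K' i) (i : ℤ) :
    cycles K i ≤ boundaries K i ↔ i ≠ A.card - 1 := by
  classical
  have hle : K' ≤ K := fun σ hσ => ((hK σ).1 hσ).1
  have hchains : ∀ j : ℤ, j ≠ A.card - 1 → chains K j ≤ chains K' j := by
    refine fun j hj => Finsupp.supported_mono ?_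
    rintro σ ⟨hσ, hσj⟩
    refine ⟨(hK σ).2 ⟨hσ, ?_⟩, hσj⟩
    rintro rfl
    omega
  constructor
  · rintro h rfl
    have hAc : Finsupp.single A (1 : ZMod 2) ∈ chains K ((A.card : ℤ) - 2 + 1) :=
      Finsupp.single_mem_supported _ _ ⟨hA, by omega⟩
    obtain ⟨c, hc, hcA⟩ := hK' ((A.card : ℤ) - 2)
      ⟨hchains _ (by omega) (boundary_mem_chains hAc), boundary_boundary _⟩
    have hidx : (A.card : ℤ) - 2 + 1 = A.card - 1 := by ring
    rw [hidx] at hc hAc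
    -- The cycle `A + c` has coefficient 1 at `A`, but a boundary has coefficient 0 there because no
    -- larger face contains `A`.
    obtain ⟨w, hw, hwz⟩ := h (x := Finsupp.single A 1 + c)
      ⟨Submodule.add_mem _ hAc (chains_mono hle _ hc), by
        change boundary _ = 0
        rw [map_add, hcA, add_self_chain]⟩
    have hcz : c A = 0 := by
      by_contra hne
      exact ((hK A).1 (mem_of_mem_chains hc hne).1).2 rfl
    have hw0 : contract A w = 0 := by
      have := map_mem_of_mem_supported (N := ⊥) (contract A) ?_ hw
      · simpa using this
      · rintro σ ⟨hσ, hσi⟩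
        rw [contract_single, if_neg]
        · exact Submodule.zero_mem _
        · intro hAσ
          rw [hmax σ hσ hAσ] at hσi
          omega
    have h1 := contract_apply (Finset.disjoint_empty_right A) (boundary w)
    rw [contract_boundary, hw0, map_zero, Finset.union_empty, hwz, Finsupp.add_apply, hcz,
      Finsupp.single_eq_same, add_zero, Finsupp.zero_apply] at h1
    exact zero_ne_one h1
  · rintro hi z ⟨hz, hz0⟩
    obtain ⟨w, hw, hwz⟩ := hK' i ⟨hchains i hi hz, hz0⟩
    exact ⟨w, chains_mono hle _ hw, hwz⟩

end FiberwiseCone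

theorem add_one_le_choose_add {d : ℕ} (hd : 1 ≤ d) (a : ℕ) : a + 1 ≤ a.choose d + d := by
  rcases lt_or_ge a d with h | h
  · omega
  · induction a, h using Nat.le_induction with
    | base => simp
    | succ a ha ih =>
      obtain ⟨e, rfl⟩ : ∃ e, d = e + 1 := ⟨d - 1, by omega⟩
      rw [Nat.choose_succ_succ']
      have : 0 < a.choose e := Nat.choose_pos (by omega)
      omega

/-! ### The complex of `A ∪ B`: size of faces and homology. -/

section Transversal

variable {d : ℕ} {A B : Finset (EuclideanSpace ℝ (Fin d))}

local notation "𝔼" => EuclideanSpace ℝ (Fin d)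

theorem mem_generalPositionComplex {P : Set 𝔼} {σ : Finset 𝔼} :
    σ ∈ generalPositionComplex P ↔ (σ : Set 𝔼) ⊆ P ∧ InGeneralPosition (σ : Set 𝔼) :=
  Iff.rfl

theorem IsGenericTransversal.mem_complex_iff (h : IsGenericTransversal A B) {σ : Finset 𝔼} :
    σ ∈ generalPositionComplex ((A : Set 𝔼) ∪ B) ↔ (σ : Set 𝔼) ⊆ (A : Set 𝔼) ∪ B ∧
      ∀ S ⊆ A, S.card = d → S ⊆ σ → ∀ x ∈ B, x ∈ affineSpan ℝ (S : Set 𝔼) → x ∉ σ := by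
  classical
  rw [mem_generalPositionComplex]
  refine and_congr_right fun hσ => ⟨?_, ?_⟩
  · intro hgp S hSA hSd hSσ x hxB hxS hxσ
    have hxS' : x ∉ S := fun h' => Finset.disjoint_left.1 h.disjoint (hSA h') hxB
    refine not_affIndep_insert (by simpa using hxS') hxS ?_
    have := hgp.affIndep (T := insert x S) (Finset.coe_subset.2 (Finset.insert_subset hxσ hSσ))
      (by rw [Finset.card_insert_of_notMem hxS', hSd])
    rwa [Finset.coe_insert] at this
  · intro hno T hT hc
    by_contra hdep
    obtain ⟨S, hSA, hSd, x, hxB, hxS, hTe⟩ := h.generic T (hT.trans hσ) hc hdep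
    rw [hTe] at hT
    exact hno S hSA hSd (fun s hs => hT (Set.mem_insert_of_mem _ hs)) x hxB hxS
      (hT (Set.mem_insert _ _))

theorem IsGenericTransversal.exists_point (h : IsGenericTransversal A B) :
    ∃ x : Finset 𝔼 → 𝔼, (∀ S ∈ A.powersetCard d, x S ∈ B ∧ x S ∈ affineSpan ℝ (S : Set 𝔼)) ∧
      Set.InjOn x (A.powersetCard d : Set (Finset 𝔼)) ∧
      ∀ y ∈ B, ∃ S ∈ A.powersetCard d, x S = y := by
  classical
  have hex : ∀ S : Finset 𝔼, ∃ x : 𝔼, S ∈ A.powersetCard d →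
      x ∈ B ∧ x ∈ affineSpan ℝ (S : Set 𝔼) := by
    intro S
    by_cases hS : S ∈ A.powersetCard d
    · obtain ⟨hSA, hSd⟩ := Finset.mem_powersetCard.1 hS
      obtain ⟨x, hx⟩ := Set.ncard_eq_one.1 (h.meets S hSA hSd)
      have hx' : x ∈ ({x} : Set 𝔼) := rfl
      rw [← hx] at hx'
      exact ⟨x, fun _ => hx'⟩
    · exact ⟨0, fun h => absurd h hS⟩
  choose x hx using hex
  have hinj : Set.InjOn x (A.powersetCard d : Set (Finset 𝔼)) := by
    intro S hS S' hS' he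
    obtain ⟨hSA, hSd⟩ := Finset.mem_powersetCard.1 hS
    obtain ⟨hSA', hSd'⟩ := Finset.mem_powersetCard.1 hS'
    exact h.injective S hSA hSd S' hSA' hSd' (x S) (hx S hS).1 (hx S hS).2 (he ▸ (hx S' hS').2)
  refine ⟨x, hx, hinj, fun y hy => ?_⟩
  have himg : (A.powersetCard d).image x = B := by
    refine Finset.eq_of_subset_of_card_le ?_ ?_
    · rintro y hy
      obtain ⟨S, hS, rfl⟩ := Finset.mem_image.1 hy
      exact (hx S hS).1
    · rw [Finset.card_image_of_injOn hinj, Finset.card_powersetCard, h.card_eq]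
  rw [← himg] at hy
  exact Finset.mem_image.1 hy

/-- A face with `a` points in `A` misses the `a.choose d` points of `B` on the hyperplanes spanned
by them; `add_one_le_choose_add` shows that this loss outweighs all but `d - 1` of the gained
points. -/
theorem IsGenericTransversal.card_le (hd : 1 ≤ d) (h : IsGenericTransversal A B) {σ : Finset 𝔼}
    (hσ : σ ∈ generalPositionComplex ((A : Set 𝔼) ∪ B)) : σ.card ≤ A.card.choose d + d - 1 := by
  classical
  obtain ⟨hσP, hσ⟩ := h.mem_complex_iff.1 hσ
  obtain ⟨x, hx, hinj, -⟩ := h.exists_point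
  have hsub : (σ ∩ A).powersetCard d ⊆ A.powersetCard d :=
    Finset.powersetCard_mono Finset.inter_subset_right
  have h1 : ((σ ∩ A).powersetCard d).image x ⊆ B \ σ := by
    intro y hy
    obtain ⟨S, hS, rfl⟩ := Finset.mem_image.1 hy
    obtain ⟨hS1, hS2⟩ := Finset.mem_powersetCard.1 hS
    have hxS := hx S (hsub hS)
    exact Finset.mem_sdiff.2 ⟨hxS.1, hσ S (hS1.trans Finset.inter_subset_right) hS2
      (hS1.trans Finset.inter_subset_left) _ hxS.1 hxS.2⟩
  have h2 := Finset.card_le_card h1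
  rw [Finset.card_image_of_injOn (hinj.mono (Finset.coe_subset.2 hsub)),
    Finset.card_powersetCard] at h2
  have h3 : σ = σ ∩ A ∪ σ ∩ B := by
    rw [← Finset.inter_union_distrib_left]
    refine (Finset.inter_eq_left.2 ?_).symm
    rwa [← Finset.coe_subset, Finset.coe_union]
  have h4 : σ.card ≤ (σ ∩ A).card + (σ ∩ B).card := by
    nth_rewrite 1 [h3]
    exact Finset.card_union_le _ _
  have h5 := Finset.card_sdiff_add_card_inter B σ
  rw [Finset.inter_comm, h.card_eq] at h5
  have h6 := add_one_le_choose_add hd (σ ∩ A).card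
  omega

theorem IsGenericTransversal.maxGeneralPosition_eq (hd : 1 ≤ d) (hdA : d < A.card)
    (h : IsGenericTransversal A B) :
    maxGeneralPosition ((A : Set 𝔼) ∪ B) = ((A.card.choose d + d - 1 : ℕ) : ℕ∞) := by
  classical
  refine le_antisymm (iSup₂_le fun σ hσ => Nat.cast_le.2 (h.card_le hd hσ)) ?_
  -- With only `d - 1` points of `A`, no hyperplane is spanned and all of `B` may be added.
  obtain ⟨A', hA', hcard⟩ := Finset.exists_subset_card_eq (s := A) (n := d - 1) (by omega)
  have hdisj : Disjoint A' B := h.disjoint.mono_left hA'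
  refine le_iSup₂_of_le (A' ∪ B) ?_ ?_
  · refine h.mem_complex_iff.2 ⟨?_, ?_⟩
    · rw [Finset.coe_union]
      exact Set.union_subset_union_left _ (Finset.coe_subset.2 hA')
    · intro S hSA hSd hS
      exfalso
      have : S ⊆ A' := fun s hs => (Finset.mem_union.1 (hS hs)).resolve_right
        (Finset.disjoint_left.1 h.disjoint (hSA hs))
      have := Finset.card_le_card this
      omega
  · rw [Finset.card_union_of_disjoint hdisj, h.card_eq, hcard, Nat.cast_le]
    omega

/-- The complex of all faces of `K` other than the facet `A`. -/
def eraseFacet {V : Type*} (K : LowerSet (Finset V)) (A : Finset V)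
    (hmax : ∀ σ ∈ K, A ⊆ σ → σ = A) : LowerSet (Finset V) where
  carrier := {σ | σ ∈ K ∧ σ ≠ A}
  lower' := by
    rintro σ τ hτ ⟨hσ, hσA⟩
    refine ⟨K.lower hτ hσ, ?_⟩
    rintro rfl
    exact hσA (hmax σ hσ hτ)

theorem IsGenericTransversal.cycles_le_boundaries_iff (hd : 1 ≤ d) (hdA : d < A.card)
    (hA : InGeneralPosition (A : Set 𝔼)) (h : IsGenericTransversal A B) (i : ℤ) :
    cycles (generalPositionComplex ((A : Set 𝔼) ∪ B)) i ≤
      boundaries (generalPositionComplex ((A : Set 𝔼) ∪ B)) i ↔ i ≠ A.card - 1 := by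
  obtain ⟨x, hx, hinj, hsurj⟩ := h.exists_point
  have hmax : ∀ σ ∈ generalPositionComplex ((A : Set 𝔼) ∪ B), A ⊆ σ → σ = A := by
    intro σ hσ hAσ
    obtain ⟨hσP, hσ⟩ := h.mem_complex_iff.1 hσ
    refine Finset.Subset.antisymm (fun y hy => ?_) hAσ
    rcases hσP hy with hyA | hyB
    · exact hyA
    · obtain ⟨S, hS, rfl⟩ := hsurj y hyB
      obtain ⟨hS1, hS2⟩ := Finset.mem_powersetCard.1 hS
      exact absurd hy (hσ S hS1 hS2 (hS1.trans hAσ) _ hyB (hx S hS).2)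
  have hb : ∀ τ : Finset 𝔼, ∃ b : 𝔼, τ ⊆ A → τ ≠ A →
      b ∈ B ∧ ∀ S ⊆ τ, S.card = d → b ∉ affineSpan ℝ (S : Set 𝔼) := by
    intro τ
    by_cases hτ : τ ⊆ A ∧ τ ≠ A
    -- Since `a ∈ S` and `a ∉ τ`, `S` is not a subset of `τ`, and the point on its hyperplane lies
    -- on no other.
    · obtain ⟨a, haA, haτ⟩ := Finset.exists_of_ssubset (hτ.1.ssubset_of_ne hτ.2)
      obtain ⟨S, haS, hSA, hSd⟩ := Finset.exists_subsuperset_card_eq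
        (Finset.singleton_subset_iff.2 haA) (by rwa [Finset.card_singleton]) hdA.le
      have hS := hx S (Finset.mem_powersetCard.2 ⟨hSA, hSd⟩)
      refine ⟨x S, fun _ _ => ⟨hS.1, fun S' hS' hSd' hxS' => haτ (hS' ?_)⟩⟩
      rw [← h.injective S hSA hSd S' (hS'.trans hτ.1) hSd' _ hS.1 hS.2 hxS']
      exact haS (Finset.mem_singleton_self a)
    · exact ⟨0, fun h1 h2 => absurd ⟨h1, h2⟩ hτ⟩
  choose b hb using hb
  refine cycles_le_boundaries_iff_of_facet (K' := eraseFacet _ A hmax) (fun σ => Iff.rfl)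
    ⟨Set.subset_union_left, hA⟩ hmax
    (cycles_le_boundaries_of_fiberwise_cone (A := A) (b := b) ?_ ?_) i
  · rintro σ ⟨hσ, hσA⟩ hbA
    refine Finset.disjoint_left.1 h.disjoint hbA (hb _ Finset.inter_subset_right ?_).1
    exact fun he => hσA (hmax σ hσ (Finset.inter_eq_right.1 he))
  · rintro σ ⟨hσ, hσA⟩
    obtain ⟨hbB, hbS⟩ := hb _ (Finset.inter_subset_right (s₁ := σ) (s₂ := A))
      fun he => hσA (hmax σ hσ (Finset.inter_eq_right.1 he))
    obtain ⟨hσP, hσ⟩ := h.mem_complex_iff.1 hσ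
    refine ⟨h.mem_complex_iff.2 ⟨?_, ?_⟩, fun he => ?_⟩
    · rw [Finset.coe_insert]
      exact Set.insert_subset (Or.inr hbB) hσP
    · intro S hSA hSd hS y hyB hyS hy
      have hSσ : S ⊆ σ := fun s hs => (Finset.mem_insert.1 (hS hs)).resolve_left fun he =>
        Finset.disjoint_left.1 h.disjoint (hSA hs) (he ▸ hbB)
      rcases Finset.mem_insert.1 hy with rfl | hy
      · exact hbS S (Finset.subset_inter hSσ hSA) hSd hyS
      · exact hσ S hSA hSd hSσ y hyB hyS hy
    · exact Finset.disjoint_left.1 h.disjoint (he.subset (Finset.mem_insert_self _ _)) hbB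

end Transversal

end GenPos

/-! ### Connectivity from large general position subsets, and the growth of `g`. -/

namespace GenPos

theorem card_filter_card_le {α : Type*} (T : Finset α) (d : ℕ) :
    (T.powerset.filter fun S => S.card ≤ d).card ≤ (T.card + 1) ^ d := by
  classical
  have h1 : (T.powerset.filter fun S => S.card ≤ d) ⊆
      (Finset.range (d + 1)).biUnion fun j => T.powersetCard j := by
    intro S hS
    obtain ⟨hST, hSd⟩ := Finset.mem_filter.1 hS
    exact Finset.mem_biUnion.2 ⟨S.card, Finset.mem_range.2 (by omega),
      Finset.mem_powersetCard.2 ⟨Finset.mem_powerset.1 hST, rfl⟩⟩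
  refine (Finset.card_le_card h1).trans (Finset.card_biUnion_le.trans ?_)
  rw [add_pow]
  refine Finset.sum_le_sum fun j hj => ?_
  rw [Finset.card_powersetCard, one_pow, mul_one]
  have hj' : 0 < d.choose j := Nat.choose_pos (by rw [Finset.mem_range] at hj; omega)
  exact (Nat.choose_le_pow _ _).trans (Nat.le_mul_of_pos_right _ hj')

section Connectivity

variable {d : ℕ}

local notation "𝔼" => EuclideanSpace ℝ (Fin d)

theorem exists_face_card_ge {P : Set 𝔼} {m : ℕ} (hm : (m : ℕ∞) ≤ maxGeneralPosition P) :
    ∃ σ ∈ generalPositionComplex P, m ≤ σ.card := by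
  by_contra! h
  rcases Nat.eq_zero_or_pos m with rfl | h0
  · have : (∅ : Finset 𝔼) ∈ generalPositionComplex P := by
      refine ⟨by simp, fun T hT _ => ?_⟩
      rw [Finset.coe_empty, Set.subset_empty_iff] at hT
      change AffIndep (T : Set 𝔼)
      rw [hT]
      exact affIndep_empty
    exact absurd (h _ this) (Nat.not_lt_zero _)
  · have : maxGeneralPosition P ≤ ((m - 1 : ℕ) : ℕ∞) :=
      iSup₂_le fun σ hσ => Nat.cast_le.2 (by have := h σ hσ; omega)
    have := Nat.cast_le.1 (hm.trans this)
    omega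

/-- A finite set `Q` in general position contains a point outside all flats that are spanned by at
most `d` points of a given set `T`, if `Q` is large compared to `T`. -/
theorem exists_mem_forall_notMem_affineSpan {Q T : Finset 𝔼} (hQ : InGeneralPosition (Q : Set 𝔼))
    (hcard : T.card + d * (T.card + 1) ^ d < Q.card) :
    ∃ q ∈ Q, q ∉ T ∧ ∀ S ⊆ T, S.card ≤ d → q ∉ affineSpan ℝ (S : Set 𝔼) := by
  classical
  set I := T.powerset.filter fun S => S.card ≤ d with hI
  set bad := T ∪ I.biUnion fun S => Q.filter fun q => q ∈ affineSpan ℝ (S : Set 𝔼) with hbad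
  have hb : bad.card < Q.card := by
    refine lt_of_le_of_lt ((Finset.card_union_le _ _).trans ?_) hcard
    refine Nat.add_le_add_left (Finset.card_biUnion_le.trans ?_) _
    -- Any `d + 1` points of `Q` are independent, so they do not fit in a flat spanned by `d`
    -- points.
    refine (Finset.sum_le_card_nsmul I _ d fun S hS => ?_).trans ?_
    · obtain ⟨-, hSd⟩ := Finset.mem_filter.1 hS
      by_contra! hlt
      obtain ⟨R, hR, hRd⟩ := Finset.exists_subset_card_eq (Nat.succ_le_of_lt hlt)
      have hRi : AffIndep (R : Set 𝔼) := hQ.affIndep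
        (Finset.coe_subset.2 (hR.trans (Finset.filter_subset _ _))) (by omega)
      have := AffineIndependent.card_le_card_of_subset_affineSpan (t := S) hRi
        fun r hr => (Finset.mem_filter.1 (hR hr)).2
      omega
    · rw [smul_eq_mul, mul_comm]
      exact Nat.mul_le_mul_left _ (card_filter_card_le T d)
  obtain ⟨q, hq, hqb⟩ := Finset.exists_mem_notMem_of_card_lt_card hb
  rw [hbad, Finset.mem_union, not_or] at hqb
  refine ⟨q, hq, hqb.1, fun S hS hSd hqS => hqb.2 (Finset.mem_biUnion.2 ⟨S, ?_, ?_⟩)⟩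
  · exact Finset.mem_filter.2 ⟨Finset.mem_powerset.2 hS, hSd⟩
  · exact Finset.mem_filter.2 ⟨hq, hqS⟩

theorem exists_minimal_not_affIndep {T : Finset 𝔼} (hT : ¬ AffIndep (T : Set 𝔼)) :
    ∃ f ⊆ T, ¬ AffIndep (f : Set 𝔼) ∧ ∀ S, S ⊂ f → AffIndep (S : Set 𝔼) := by
  induction T using Finset.strongInduction with
  | H T ih =>
    by_cases h : ∃ S, S ⊂ T ∧ ¬ AffIndep (S : Set 𝔼)
    · obtain ⟨S, hST, hS⟩ := h
      obtain ⟨f, hf, hf'⟩ := ih S hST hS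
      exact ⟨f, hf.trans hST.subset, hf'⟩
    · push Not at h
      exact ⟨T, subset_rfl, hT, h⟩

theorem cycles_finite_le_boundaries {W Q : Finset 𝔼} {k : ℕ} (hQW : Q ⊆ W)
    (hQ : InGeneralPosition (Q : Set 𝔼))
    (hcard : 2 * k + 2 + d * (2 * k + 3) ^ d < Q.card) {i : ℤ} (hi : i ≤ k) :
    cycles (generalPositionComplex (W : Set 𝔼)) i ≤
      boundaries (generalPositionComplex (W : Set 𝔼)) i := by
  classical
  -- Minimality makes `f.erase q` independent, so each `q ∈ f` lies in the span of the rest: what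
  -- `q` was chosen to avoid.
  set F : Finset (Finset 𝔼) := W.powerset.filter fun f => f.card ≤ d + 1 ∧
    ¬ AffIndep (f : Set 𝔼) ∧ ∀ S, S ⊂ f → AffIndep (S : Set 𝔼)
  have hK : generalPositionComplex (W : Set 𝔼) = forbiddenLink W F ∅ := by
    refine SetLike.ext fun σ => ?_
    rw [mem_generalPositionComplex, mem_forbiddenLink_empty, Finset.coe_subset]
    refine and_congr_right fun hσW => ?_
    constructor
    · intro hσ f hf hfσ
      obtain ⟨-, hfd, hf, -⟩ := Finset.mem_filter.1 hf
      exact hf (hσ.affIndep (Finset.coe_subset.2 hfσ) hfd)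
    · intro hσ T hT hc
      by_contra hdep
      rw [Finset.coe_subset] at hT
      obtain ⟨f, hfT, hf⟩ := exists_minimal_not_affIndep hdep
      exact hσ f (Finset.mem_filter.2 ⟨Finset.mem_powerset.2 ((hfT.trans hT).trans hσW),
        (Finset.card_le_card hfT).trans hc, hf⟩) (hfT.trans hT)
  rw [hK]
  refine cycles_forbiddenLink_le_boundaries (F₀ := F) (k := k)
    (fun f hf => Finset.mem_powerset.1 (Finset.mem_filter.1 hf).1) ?_ (i + 2).toNat F subset_rfl
    i (Int.self_le_toNat _) ∅ (Finset.empty_subset _) ?_ (by simp; omega)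
  · intro T _ hT
    obtain ⟨q, hqQ, hqT, hq⟩ := exists_mem_forall_notMem_affineSpan (T := T) hQ (by
      refine lt_of_le_of_lt (Nat.add_le_add hT (Nat.mul_le_mul_left _ ?_)) hcard
      exact Nat.pow_le_pow_left (by omega) _)
    refine ⟨q, hQW hqQ, hqT, fun f hf hqf hfT => ?_⟩
    obtain ⟨-, hfd, hfdep, hfmin⟩ := Finset.mem_filter.1 hf
    have hce := Finset.card_erase_add_one hqf
    refine hq (f.erase q) (Finset.subset_insert_iff.1 hfT) (by omega) ?_
    refine mem_affineSpan_of_not_affIndep_insert (hfmin _ (Finset.erase_ssubset hqf)) ?_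
    rwa [← Finset.coe_insert, Finset.insert_erase hqf]
  · intro f hf hf0
    obtain ⟨-, -, hfdep, -⟩ := Finset.mem_filter.1 hf
    rw [Finset.subset_empty.1 hf0, Finset.coe_empty] at hfdep
    exact hfdep affIndep_empty

theorem generalPositionComplex_mono {P P' : Set 𝔼} (h : P ⊆ P') :
    generalPositionComplex P ≤ generalPositionComplex P' :=
  fun _ hσ => ⟨hσ.1.trans h, hσ.2⟩

theorem mem_connectivityThresholds (d k : ℕ) :
    2 * k + 3 + d * (2 * k + 3) ^ d ∈ connectivityThresholds d k := by
  classical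
  intro P hP i _ hi
  rw [subsingleton_reducedHomology_iff]
  obtain ⟨Q, hQ, hcard⟩ := exists_face_card_ge hP
  rintro z ⟨hz, hz0⟩
  -- A finite part of `P` carrying both the cycle and the large set `Q`.
  set W := Q ∪ z.support.biUnion id with hW
  have hWP : (W : Set (EuclideanSpace ℝ (Fin d))) ⊆ P := by
    intro w hw
    rcases Finset.mem_union.1 hw with hw | hw
    · exact hQ.1 hw
    · obtain ⟨σ, hσ, hwσ⟩ := Finset.mem_biUnion.1 hw
      exact (hz hσ).1.1 hwσ
  have hzW : z ∈ chains (generalPositionComplex (W : Set (EuclideanSpace ℝ (Fin d)))) i := by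
    intro σ hσ
    refine ⟨⟨fun w hw => Finset.mem_union_right _ (Finset.mem_biUnion.2 ⟨σ, hσ, hw⟩),
      (hz hσ).1.2⟩, (hz hσ).2⟩
  obtain ⟨w, hw, hwz⟩ := cycles_finite_le_boundaries (k := k) Finset.subset_union_left hQ.2
    (by omega) hi ⟨hzW, hz0⟩
  exact ⟨w, chains_mono (generalPositionComplex_mono hWP) _ hw, hwz⟩

theorem isLeast_g (d k : ℕ) : IsLeast (connectivityThresholds d k) (g d k) :=
  ⟨Nat.sInf_mem ⟨_, mem_connectivityThresholds d k⟩, fun _ hm => Nat.sInf_le hm⟩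

/-- Taking `|A| = k + 1` puts the nonzero homology exactly in degree `k`. -/
theorem choose_le_g (hd : 2 ≤ d) {k : ℕ} (hk : d ≤ k) : (k + 1).choose d ≤ g d k := by
  obtain ⟨A, hAc, hA⟩ := exists_inGeneralPosition (d := d) (by omega) (k + 1)
  obtain ⟨B, hB⟩ := exists_isGenericTransversal hd hA
  by_contra! hlt
  have hmax := hB.maxGeneralPosition_eq (by omega) (by omega)
  have hcon := (isLeast_g d k).1 ((A : Set 𝔼) ∪ B) (by
    rw [hmax, Nat.cast_le, hAc]
    omega) k (by omega) le_rfl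
  rw [subsingleton_reducedHomology_iff,
    hB.cycles_le_boundaries_iff (by omega) (by omega) hA, hAc] at hcon
  push_cast at hcon
  omega

theorem isTheta_g (hd : 2 ≤ d) :
    (fun k : ℕ => (g d k : ℝ)) =Θ[atTop] (fun k : ℕ => (k : ℝ) ^ d) := by
  constructor
  -- The 5 comes from `2k + 3 ≤ 5k` for `k ≥ 1`.
  · refine IsBigO.of_bound ((d + 1) * 5 ^ d : ℝ) ?_
    filter_upwards [eventually_ge_atTop 1] with k hk
    have h1 : g d k ≤ (d + 1) * 5 ^ d * k ^ d := by
      have h2 : 2 * k + 3 ≤ (2 * k + 3) ^ d := Nat.le_self_pow (by omega) _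
      have h3 : (2 * k + 3) ^ d ≤ (5 * k) ^ d := Nat.pow_le_pow_left (by omega) _
      calc g d k ≤ 2 * k + 3 + d * (2 * k + 3) ^ d :=
            (isLeast_g d k).2 (mem_connectivityThresholds d k)
        _ ≤ (2 * k + 3) ^ d + d * (2 * k + 3) ^ d := Nat.add_le_add_right h2 _
        _ = (d + 1) * (2 * k + 3) ^ d := by ring
        _ ≤ (d + 1) * (5 * k) ^ d := Nat.mul_le_mul_left _ h3
        _ = (d + 1) * 5 ^ d * k ^ d := by rw [mul_pow, mul_assoc]
    rw [Real.norm_of_nonneg (by positivity), Real.norm_of_nonneg (by positivity)]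
    exact_mod_cast h1
  -- For `k ≥ 2d` each factor of the descending factorial is at least `k / 2`.
  · refine IsBigO.of_bound (2 ^ d * d.factorial : ℝ) ?_
    filter_upwards [eventually_ge_atTop (2 * d)] with k hk
    rw [Real.norm_of_nonneg (by positivity), Real.norm_of_nonneg (by positivity)]
    have h1 : (k + 1 + 1 - d) ^ d ≤ d.factorial * (k + 1).choose d := by
      rw [← Nat.descFactorial_eq_factorial_mul_choose]
      exact Nat.pow_sub_le_descFactorial _ _
    have h2 : k ^ d ≤ 2 ^ d * d.factorial * g d k := by
      calc k ^ d ≤ (2 * (k + 1 + 1 - d)) ^ d := Nat.pow_le_pow_left (by omega) _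
        _ = 2 ^ d * (k + 1 + 1 - d) ^ d := mul_pow _ _ _
        _ ≤ 2 ^ d * (d.factorial * (k + 1).choose d) := Nat.mul_le_mul_left _ h1
        _ ≤ 2 ^ d * (d.factorial * g d k) := by
          gcongr
          exact choose_le_g hd (by omega)
        _ = 2 ^ d * d.factorial * g d k := by ring
    exact_mod_cast h2

end Connectivity

end GenPos

theorem mainTheorem9 (d : ℕ) (hd : 2 ≤ d) :
    -- the point sets `A` and `B` exist
    (∀ n : ℕ, ∃ A : Finset (EuclideanSpace ℝ (Fin d)),
      A.card = n ∧ GenPos.InGeneralPosition (A : Set (EuclideanSpace ℝ (Fin d)))) ∧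
    (∀ A : Finset (EuclideanSpace ℝ (Fin d)), d < A.card →
      GenPos.InGeneralPosition (A : Set (EuclideanSpace ℝ (Fin d))) →
      ∃ B : Finset (EuclideanSpace ℝ (Fin d)), GenPos.IsGenericTransversal A B) ∧
    -- the size, the maximal general position subsets and the homology of `P = A ∪ B`
    (∀ (n : ℕ) (A B : Finset (EuclideanSpace ℝ (Fin d))) (P : Set (EuclideanSpace ℝ (Fin d))),
      d < n → A.card = n →
      GenPos.InGeneralPosition (A : Set (EuclideanSpace ℝ (Fin d))) →
      GenPos.IsGenericTransversal A B →
      P = (A : Set (EuclideanSpace ℝ (Fin d))) ∪ (B : Set (EuclideanSpace ℝ (Fin d))) →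
      P.ncard = n.choose d + n ∧
      GenPos.maxGeneralPosition P = ((n.choose d + d - 1 : ℕ) : ℕ∞) ∧
      ∀ i : ℤ,
        Subsingleton (GenPos.ReducedHomology (GenPos.generalPositionComplex P) i) ↔
          i ≠ (n : ℤ) - 1) ∧
    -- `g_d(k)` is well defined, and it has order of growth `k^d`
    (∀ k : ℕ, IsLeast (GenPos.connectivityThresholds d k) (GenPos.g d k)) ∧
    (fun k : ℕ => (GenPos.g d k : ℝ)) =Θ[Filter.atTop] (fun k : ℕ => (k : ℝ) ^ d) := by
  refine ⟨GenPos.exists_inGeneralPosition (by omega),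
    fun A _ hA => GenPos.exists_isGenericTransversal hd hA, ?_, GenPos.isLeast_g d,
    GenPos.isTheta_g hd⟩
  rintro n A B P hn rfl hA hB rfl
  refine ⟨?_, hB.maxGeneralPosition_eq (by omega) hn, fun i => ?_⟩
  · rw [Set.ncard_union_eq (Finset.disjoint_coe.2 hB.disjoint), Set.ncard_coe_finset,
      Set.ncard_coe_finset, hB.card_eq, add_comm]
  · rw [GenPos.subsingleton_reducedHomology_iff, hB.cycles_le_boundaries_iff (by omega) hn hA]
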